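/- Setting. For each $n\in\mathbb N$ let $f_1,\dots,f_M\in\mathbb R^N$ be fingerprints ($N=N_n$, $M=M_n$) of common energy $\|f_m\|^2=ND_f$ such that the unit vectors $f_m/\|f_m\|$ form an equiangular tight frame (the $N\times M$ matrix with these columns has orthogonal rows of equal norm, and all $|\langle f_i,f_j\rangle|$, $i\ne j$, are equal). Let $\mu=\max_{i\neq j}|\langle f_i,f_j\rangle|/(\|f_i\|\|f_j\|)$. A coalition $\mathcal K\subseteq\{1,\dots,M\}$ of exactly $K=K_n\ge 1$ users attacks with uniform weights $\alpha_k=1/K$, so that, after subtraction of the host signal, the forgery is $$z=\sum_{k\in\mathcal K}\alpha_kf_k+\epsilon ,$$ where $\epsilon$ has independent $\mathcal N(0,\sigma^2)$ coordinates, $\sigma>0$. The watermark-to-noise ratio is $0$ dB, i.e. $D_f=\sigma^2$. User $m$ is declared guilty exactly when $T_m(z):=\langle z,f_m\rangle/\|f_m\|^2\ge\tau$. Put $$P_{\mathrm I}(\tau)=\max_{|\mathcal K|=K}\ \max_{m\notin\mathcal K}\Pr[T_m(z)\ge\tau],\qquad P_{\mathrm{II}}(\tau)=\max_{|\mathcal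 K|=K}\ \min_{m\in\mathcal K}\Pr[T_m(z)<\tau],$$ and $P_e(\tau)=\max\{P_{\mathrm I}(\tau),P_{\mathrm{II}}(\tau)\}$. Claim. Suppose $N\to\infty$, $M/N\to\infty$ and $N/K^2\to\infty$ as $n\to\infty$ ($K$ may be fixed or vary with $n$; $\sigma$ may vary as well). Then, for all large $n$, the minimum of $P_e$ over $\tau\in\mathbb R$ is attained. Moreover, if $\tau^*=\tau^*_n$ is, for all large $n$, a minimizer of $P_e$, and likewise if $\tau^*_n=\frac{1+\mu}{2K}$ for all large $n$, then $$-\frac1N\ln P_e(\tau^*)\ \sim\ \frac1{8K^2}\qquad(n\to\infty),$$ that is, the ratio of the two sides tends to $1$. In particular, if $K$ is fixed, then the error exponent is $$-\lim_{n\to\infty}\frac1N\ln P_e(\tau^*)=\frac1{8K^2}.$$ -/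

import Mathlib

open Filter Topology MeasureTheory ProbabilityTheory Asymptotics

noncomputable section

namespace Fingerprint

/-- An equiangular tight frame of `M` vectors in `ℝ^N`: the `N × M` matrix with columns `φ m`
has orthogonal rows of equal norm, and its columns are unit vectors whose pairwise inner products
have equal magnitude. -/
structure IsETF {N M : ℕ} (φ : Fin M → EuclideanSpace ℝ (Fin N)) : Prop where
  tight : ∃ A : ℝ, ∀ i j : Fin N, ∑ m, φ m i * φ m j = if i = j then A else 0
  unit_norm : ∀ m, ‖φ m‖ = 1
  equiangular : ∃ c : ℝ, ∀ m m' : Fin M, m ≠ m' → |inner ℝ (φ m) (φ m')| = c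

/-- The fingerprints, scaled to unit norm. -/
def normalized {N M : ℕ} (f : Fin M → EuclideanSpace ℝ (Fin N)) :
    Fin M → EuclideanSpace ℝ (Fin N) :=
  fun m => ‖f m‖⁻¹ • f m

/-- Worst-case coherence `max_{i ≠ j} |⟨φ i, φ j⟩|`. -/
def coherence {N M : ℕ} (φ : Fin M → EuclideanSpace ℝ (Fin N)) : ℝ :=
  ⨆ p : {p : Fin M × Fin M // p.1 ≠ p.2}, |inner ℝ (φ p.1.1) (φ p.1.2)|

/-- White Gaussian noise in `ℝ^N`: independent coordinates of mean `0` and variance `σ ^ 2`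
(total variance `N * σ ^ 2`). -/
def noise (N : ℕ) (σ : ℝ) : Measure (Fin N → ℝ) :=
  Measure.pi fun _ => gaussianReal 0 ⟨σ ^ 2, sq_nonneg σ⟩

/-- The forgery with the host signal removed, `z = ∑ k, α k • f k + ε`. A coalition of `K` users
is an injection `𝒦 : Fin K ↪ Fin M`; the member `𝒦 k` takes part with weight `α k`. -/
def forgery {N M K : ℕ} (f : Fin M → EuclideanSpace ℝ (Fin N)) (𝒦 : Fin K ↪ Fin M)
    (α : Fin K → ℝ) (ε : Fin N → ℝ) : EuclideanSpace ℝ (Fin N) :=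
  ∑ k, α k • f (𝒦 k) + WithLp.toLp 2 ε

/-- The normalized correlation `T_m(z) = ⟨z, f m⟩ / ‖f m‖ ^ 2`. -/
def testStat {N M : ℕ} (f : Fin M → EuclideanSpace ℝ (Fin N)) (m : Fin M)
    (z : EuclideanSpace ℝ (Fin N)) : ℝ :=
  inner ℝ z (f m) / ‖f m‖ ^ 2

/-- Probability that user `m` is declared guilty, `Prob[T_m(z) ≥ τ]`
(the type I error probability when `m` is innocent). -/
def probAccused {N M K : ℕ} (f : Fin M → EuclideanSpace ℝ (Fin N)) (σ : ℝ) (m : Fin M) (τ : ℝ)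
    (𝒦 : Fin K ↪ Fin M) (α : Fin K → ℝ) : ℝ :=
  (noise N σ).real {ε | τ ≤ testStat f m (forgery f 𝒦 α ε)}

/-- Probability that user `m` is declared innocent, `Prob[T_m(z) < τ]`
(the type II error probability when `m` is guilty). -/
def probCleared {N M K : ℕ} (f : Fin M → EuclideanSpace ℝ (Fin N)) (σ : ℝ) (m : Fin M) (τ : ℝ)
    (𝒦 : Fin K ↪ Fin M) (α : Fin K → ℝ) : ℝ :=
  (noise N σ).real {ε | testStat f m (forgery f 𝒦 α ε) < τ}

/-- False alarm: the worst case over the innocent users. -/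
def probFalseAlarm {N M K : ℕ} (f : Fin M → EuclideanSpace ℝ (Fin N)) (σ τ : ℝ)
    (𝒦 : Fin K ↪ Fin M) (α : Fin K → ℝ) : ℝ :=
  ⨆ m : {m : Fin M // m ∉ Set.range 𝒦}, probAccused f σ m τ 𝒦 α

/-- Miss: the minimum over the guilty users. -/
def probMiss {N M K : ℕ} (f : Fin M → EuclideanSpace ℝ (Fin N)) (σ τ : ℝ)
    (𝒦 : Fin K ↪ Fin M) (α : Fin K → ℝ) : ℝ :=
  ⨅ k : Fin K, probCleared f σ (𝒦 k) τ 𝒦 α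

/-- Worst-case type I error probability, over all coalitions. -/
def typeI {N M K : ℕ} (f : Fin M → EuclideanSpace ℝ (Fin N)) (σ τ : ℝ) (α : Fin K → ℝ) : ℝ :=
  ⨆ 𝒦 : Fin K ↪ Fin M, probFalseAlarm f σ τ 𝒦 α

/-- Worst-case type II error probability, over all coalitions. -/
def typeII {N M K : ℕ} (f : Fin M → EuclideanSpace ℝ (Fin N)) (σ τ : ℝ) (α : Fin K → ℝ) : ℝ :=
  ⨆ 𝒦 : Fin K ↪ Fin M, probMiss f σ τ 𝒦 α

/-- Worst-case error probability `P_e(F, τ, α)`. -/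
def probError {N M K : ℕ} (f : Fin M → EuclideanSpace ℝ (Fin N)) (σ τ : ℝ) (α : Fin K → ℝ) : ℝ :=
  max (typeI f σ τ α) (typeII f σ τ α)

/-- `τ` attains the minimum of the worst-case error probability over all thresholds. -/
def IsMinmaxThreshold {N M K : ℕ} (f : Fin M → EuclideanSpace ℝ (Fin N)) (σ : ℝ)
    (α : Fin K → ℝ) (τ : ℝ) : Prop :=
  ∀ t : ℝ, probError f σ τ α ≤ probError f σ t α

/-- The uniform weights `α k = 1 / K`. -/
def uniformWeights (K : ℕ) : Fin K → ℝ := fun _ => 1 / (K : ℝ)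

/-- The threshold `(1 + μ) / (2 K)`, with `μ` the coherence of the unit-norm fingerprints. -/
def midThreshold {N M : ℕ} (f : Fin M → EuclideanSpace ℝ (Fin N)) (K : ℕ) : ℝ :=
  (1 + coherence (normalized f)) / (2 * (K : ℝ))

end Fingerprint

end

/-! Each statistic `T_m(z)` is Gaussian with variance `σ² / ‖f m‖² = 1 / N`, so every error
probability is a standard normal tail at `√N` times the gap between the threshold and a mean.
Welch's identity bounds the coherence of the frame by `1 / √N`. Hence innocent means lie within `1 /
√N` of `0`, guilty ones within `1 / √N` of `1 / K`, and after scaling by `√N` the coherence moves a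
tail argument by at most `1`. With `a = √N / K`, every threshold therefore has error at least
`gaussianTail (a / 2 + 1)` (`le_probError`), while the midpoint threshold has error at most
`gaussianTail (a / 2 - 1)` (`probError_le`); a minimizer is caught between the two. Since `a → ∞`,
bounded shifts do not affect the leading term `a² / 8` of the negative logarithm, and dividing by
`N` gives `1 / (8 K²)`. -/

namespace Fingerprint

/-! ### Gaussian tails -/

/-- Tail of the standard normal distribution. -/
noncomputable def gaussianTail (x : ℝ) : ℝ := (gaussianReal 0 1).real (Set.Ici x)

lemma gaussianTail_eq_real_Ioi (x : ℝ) :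
    gaussianTail x = (gaussianReal 0 1).real (Set.Ioi x) := by
  have := nullSingletonClass_gaussianReal (μ := 0) (v := 1) one_ne_zero
  exact (measureReal_congr Ioi_ae_eq_Ici).symm

lemma gaussianTail_eq_one_sub_cdf (x : ℝ) :
    gaussianTail x = 1 - cdf (gaussianReal 0 1) x := by
  rw [gaussianTail_eq_real_Ioi, cdf_eq_real, ← Set.compl_Iic, probReal_compl_eq_one_sub
    measurableSet_Iic]

lemma gaussianTail_antitone : Antitone gaussianTail := fun _ _ h =>
  measureReal_mono (Set.Ici_subset_Ici.2 h)

lemma gaussianTail_nonneg (x : ℝ) : 0 ≤ gaussianTail x := measureReal_nonneg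

lemma tendsto_gaussianTail_atBot : Tendsto gaussianTail atBot (𝓝 1) := by
  have h := (tendsto_cdf_atBot (gaussianReal 0 1)).const_sub 1
  simpa [funext gaussianTail_eq_one_sub_cdf] using h

lemma continuous_gaussianTail : Continuous gaussianTail := by
  rw [funext gaussianTail_eq_one_sub_cdf]
  refine continuous_const.sub (continuous_iff_continuousAt.2 fun a => ?_)
  rw [(monotone_cdf _).continuousAt_iff_leftLim_eq_rightLim, StieltjesFunction.rightLim_eq]
  have h := (cdf (gaussianReal 0 1)).measure_singleton a
  have := nullSingletonClass_gaussianReal (μ := 0) (v := 1) one_ne_zero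
  rw [measure_cdf, measure_singleton, eq_comm, ENNReal.ofReal_eq_zero] at h
  exact le_antisymm ((monotone_cdf _).leftLim_le le_rfl) (by linarith)

lemma gaussianTail_le_exp {x : ℝ} (hx : 0 ≤ x) : gaussianTail x ≤ Real.exp (-x ^ 2 / 2) := by
  have h : HasSubgaussianMGF id 1 (gaussianReal 0 1) :=
    ⟨fun t => integrable_exp_mul_gaussianReal t, fun t => by simp [mgf_id_gaussianReal]⟩
  have h' := h.measure_ge_le hx
  rw [NNReal.coe_one, mul_one] at h'
  exact h'

/-- On `[x, x + 1]` the density is smallest at the right end. The lost unit in the exponent is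
harmless at logarithmic scale. -/
lemma le_gaussianTail {x : ℝ} (hx : 0 ≤ x) :
    (√(2 * Real.pi))⁻¹ * Real.exp (-(x + 1) ^ 2 / 2) ≤ gaussianTail x := by
  have hint := integrable_gaussianPDFReal 0 1
  have h1 : gaussianTail x = ∫ y in Set.Ici x, gaussianPDFReal 0 1 y := by
    rw [gaussianTail, measureReal_def, gaussianReal_apply_eq_integral 0 one_ne_zero,
      ENNReal.toReal_ofReal (integral_nonneg fun y => gaussianPDFReal_nonneg 0 1 y)]
  have h2 : ∫ y in Set.Icc x (x + 1), gaussianPDFReal 0 1 y ≤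
      ∫ y in Set.Ici x, gaussianPDFReal 0 1 y :=
    setIntegral_mono_set hint.integrableOn
      (ae_of_all _ fun y => gaussianPDFReal_nonneg 0 1 y)
      (ae_of_all _ fun y hy => hy.1)
  have h3 : ∫ y in Set.Icc x (x + 1), gaussianPDFReal 0 1 (x + 1) ≤
      ∫ y in Set.Icc x (x + 1), gaussianPDFReal 0 1 y := by
    refine setIntegral_mono_on (by simp) hint.integrableOn measurableSet_Icc fun y hy => ?_
    simp only [gaussianPDFReal]
    gcongr
    · linarith [hy.1]
    · exact hy.2
  rw [h1]
  refine le_trans (le_of_eq ?_) (h3.trans h2)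
  simp [gaussianPDFReal]

/-! ### Linear functionals of white noise -/

lemma noise_eq_pi (N : ℕ) (σ : ℝ) :
    noise N σ = Measure.pi fun _ : Fin N => gaussianReal 0 (σ ^ 2).toNNReal := by
  rw [Real.toNNReal_of_nonneg (sq_nonneg σ)]
  rfl

/-- A linear functional of white noise is centred Gaussian. -/
lemma map_noise_linear {N : ℕ} {σ : ℝ} (w : Fin N → ℝ) (hw : σ ^ 2 * ∑ i, w i ^ 2 = 1) :
    (noise N σ).map (fun ε => ∑ i, ε i * w i) = gaussianReal 0 1 := by
  have : IsProbabilityMeasure (noise N σ) := by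
    rw [noise_eq_pi]; infer_instance
  have hm : Measurable fun ε : Fin N → ℝ => ∑ i, ε i * w i := by fun_prop
  have := Measure.isProbabilityMeasure_map (μ := noise N σ) hm.aemeasurable
  -- Characteristic functions are compared; independence factors the exponential over the
  -- coordinates.
  refine Measure.ext_of_charFun (funext fun t => ?_)
  rw [charFun_apply_real, integral_map hm.aemeasurable (by fun_prop), charFun_gaussianReal]
  have h1 : ∀ ε : Fin N → ℝ, Complex.exp (t * ((∑ i, ε i * w i : ℝ) : ℂ) * Complex.I) =
      ∏ i, Complex.exp (((t * w i : ℝ) : ℂ) * (ε i : ℂ) * Complex.I) := fun ε => by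
    rw [← Complex.exp_sum]
    congr 1
    push_cast
    rw [Finset.mul_sum, Finset.sum_mul]
    exact Finset.sum_congr rfl fun i _ => by ring
  simp_rw [h1, noise_eq_pi]
  rw [integral_fintype_prod_eq_prod
    (f := fun i (x : ℝ) => Complex.exp (((t * w i : ℝ) : ℂ) * (x : ℂ) * Complex.I))]
  simp_rw [← charFun_apply_real, charFun_gaussianReal]
  rw [← Complex.exp_sum]
  congr 1
  have hw' : (σ : ℂ) ^ 2 * ∑ i, (w i : ℂ) ^ 2 = 1 := by exact_mod_cast hw
  have h2 : ∀ i, ((t * w i : ℝ) : ℂ) * ((0 : ℝ) : ℂ) * Complex.I -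
      (((σ ^ 2).toNNReal : ℝ) : ℂ) * ((t * w i : ℝ) : ℂ) ^ 2 / 2 =
      -(t ^ 2 / 2) * ((σ : ℂ) ^ 2 * (w i : ℂ) ^ 2) := fun i => by
    rw [Real.coe_toNNReal _ (sq_nonneg σ)]
    push_cast
    ring
  have h3 := Finset.sum_congr (rfl : (Finset.univ : Finset (Fin N)) = _) fun i _ => h2 i
  refine h3.trans ?_
  rw [← Finset.mul_sum, ← Finset.mul_sum, hw']
  push_cast; simp

lemma noise_real_le {N : ℕ} {σ : ℝ} (w : Fin N → ℝ) (hw : σ ^ 2 * ∑ i, w i ^ 2 = 1) (x : ℝ) :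
    (noise N σ).real {ε | x ≤ ∑ i, ε i * w i} = gaussianTail x := by
  rw [gaussianTail, ← map_noise_linear w hw, map_measureReal_apply (by fun_prop) measurableSet_Ici]
  rfl

lemma noise_real_lt {N : ℕ} {σ : ℝ} (w : Fin N → ℝ) (hw : σ ^ 2 * ∑ i, w i ^ 2 = 1) (x : ℝ) :
    (noise N σ).real {ε | ∑ i, ε i * w i < x} = gaussianTail (-x) := by
  have hw' : σ ^ 2 * ∑ i, (-w i) ^ 2 = 1 := by simpa using hw
  rw [gaussianTail_eq_real_Ioi, ← map_noise_linear _ hw',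
    map_measureReal_apply (by fun_prop) measurableSet_Ioi]
  congr 1
  ext ε
  simp

/-! ### Coherence of an equiangular tight frame -/

/-- Welch's identity gives the coherence bound for an equiangular tight frame. -/
lemma IsETF.abs_inner_le {N M : ℕ} {φ : Fin M → EuclideanSpace ℝ (Fin N)} (h : IsETF φ)
    (hN : 1 ≤ N) {i j : Fin M} (hij : i ≠ j) : |inner ℝ (φ i) (φ j)| ≤ 1 / √N := by
  obtain ⟨A, hA⟩ := h.tight
  obtain ⟨c, hc⟩ := h.equiangular
  have hnorm : ∀ m, ∑ l, φ m l ^ 2 = 1 := fun m => by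
    rw [← EuclideanSpace.real_norm_sq_eq, h.unit_norm, one_pow]
  -- The total squared norm of the matrix, counted by rows and by columns.
  have hNA : (N : ℝ) * A = M := by
    have h1 : ∑ l : Fin N, ∑ m, φ m l * φ m l = N * A := by simp [hA]
    rw [Finset.sum_comm] at h1
    simpa [← pow_two, hnorm] using h1.symm
  have hinner : ∀ m m', inner ℝ (φ m) (φ m') = ∑ l, φ m l * φ m' l := fun m m' => by
    simp [PiLp.inner_apply, mul_comm]
  have hsum : ∑ m, inner ℝ (φ i) (φ m) ^ 2 = A := by
    have h1 : ∀ m, inner ℝ (φ i) (φ m) ^ 2 =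
        ∑ a, ∑ b, (φ i a * φ i b) * (φ m a * φ m b) := fun m => by
      rw [hinner, pow_two, Finset.sum_mul_sum]
      exact Finset.sum_congr rfl fun a _ => Finset.sum_congr rfl fun b _ => by ring
    simp_rw [h1]
    rw [Finset.sum_comm]
    simp_rw [Finset.sum_comm (s := (Finset.univ : Finset (Fin M))), ← Finset.mul_sum, hA]
    simp only [mul_ite, mul_zero, Finset.sum_ite_eq, Finset.mem_univ, if_true]
    rw [← Finset.sum_mul]
    simp [← pow_two, hnorm]
  have hsum' : 1 + ((M : ℝ) - 1) * c ^ 2 = A := by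
    rw [← hsum, ← Finset.add_sum_erase _ _ (Finset.mem_univ i)]
    have h2 : ∀ m ∈ Finset.univ.erase i, inner ℝ (φ i) (φ m) ^ 2 = c ^ 2 := fun m hm => by
      rw [← hc i m (Finset.ne_of_mem_erase hm).symm, sq_abs]
    rw [Finset.sum_congr rfl h2]
    have hM : 1 ≤ M := i.pos
    simp [h.unit_norm, Finset.card_erase_of_mem, Nat.cast_sub hM]
  have hM : (1 : ℝ) < M := by
    have : 1 < M := by
      have := i.2; have := j.2
      have : (i : ℕ) ≠ j := fun h => hij (Fin.ext h)
      omega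
    exact_mod_cast this
  have hN' : (1 : ℝ) ≤ N := by exact_mod_cast hN
  have hcN : c ^ 2 * N ≤ 1 := by
    -- Eliminating `A` gives Welch's value of `c ^ 2`; `N ≥ 1` then makes it at most `1 / N`.
    have : ((M : ℝ) - 1) * (c ^ 2 * N) = M - N := by linear_combination N * hsum' + hNA
    have : ((M : ℝ) - 1) * (c ^ 2 * N) ≤ (M - 1) * 1 := by linarith
    exact le_of_mul_le_mul_left this (by linarith)
  rw [hc i j hij, le_div_iff₀ (by positivity)]
  refine (sq_le_sq₀ ?_ zero_le_one).1 ?_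
  · exact mul_nonneg (hc i j hij ▸ abs_nonneg _) (Real.sqrt_nonneg _)
  · rw [mul_pow, Real.sq_sqrt (by positivity)]; simpa using hcN

end Fingerprint

/-! ### Means and error probabilities for one configuration -/

namespace Fingerprint

/-- The mean of the statistic of user `m` under the uniform attack. -/
noncomputable def meanStat {N M K : ℕ} (f : Fin M → EuclideanSpace ℝ (Fin N)) (𝒦 : Fin K ↪ Fin M)
    (m : Fin M) : ℝ :=
  testStat f m (∑ k, uniformWeights K k • f (𝒦 k))

lemma continuous_ciSup_of_finite {ι X : Type*} [Finite ι] [TopologicalSpace X] {g : ι → X → ℝ}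
    (hg : ∀ i, Continuous (g i)) : Continuous fun x => ⨆ i, g i x := by
  have := Fintype.ofFinite ι
  cases isEmpty_or_nonempty ι
  · simpa using continuous_const
  · simp_rw [← Finset.sup'_univ_eq_ciSup]
    exact Continuous.finset_sup'_apply _ fun i _ => hg i

lemma continuous_ciInf_of_finite {ι X : Type*} [Finite ι] [TopologicalSpace X] {g : ι → X → ℝ}
    (hg : ∀ i, Continuous (g i)) : Continuous fun x => ⨅ i, g i x := by
  have := Fintype.ofFinite ι
  cases isEmpty_or_nonempty ι
  · simpa using continuous_const
  · simp_rw [← Finset.inf'_univ_eq_ciInf]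
    exact Continuous.finset_inf'_apply _ fun i _ => hg i

section Configuration

variable {N M K : ℕ} {f : Fin M → EuclideanSpace ℝ (Fin N)} {σ : ℝ}

lemma testStat_sum_smul (m : Fin M) (c : Fin K → ℝ) (z : Fin K → EuclideanSpace ℝ (Fin N)) :
    testStat f m (∑ k, c k • z k) = ∑ k, c k * testStat f m (z k) := by
  simp only [testStat, sum_inner, real_inner_smul_left, Finset.sum_div, mul_div_assoc]

lemma abs_meanStat_le {b : ℝ} (hK : 1 ≤ K)
    (hC : ∀ m m', m ≠ m' → |testStat f m (f m')| ≤ b) {𝒦 : Fin K ↪ Fin M} {m : Fin M}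
    (hm : m ∉ Set.range 𝒦) : |meanStat f 𝒦 m| ≤ b := by
  have hK' : (0 : ℝ) < K := by exact_mod_cast hK
  rw [meanStat, testStat_sum_smul]
  calc |∑ k, uniformWeights K k * testStat f m (f (𝒦 k))|
      ≤ ∑ k, |uniformWeights K k * testStat f m (f (𝒦 k))| := Finset.abs_sum_le_sum_abs _ _
    _ ≤ ∑ _k : Fin K, 1 / (K : ℝ) * b := by
        refine Finset.sum_le_sum fun k _ => ?_
        rw [abs_mul, uniformWeights, abs_of_pos (by positivity)]
        exact mul_le_mul_of_nonneg_left (hC _ _ fun h => hm ⟨k, h.symm⟩) (by positivity)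
    _ = b := by simp; field_simp

/-- The member's own fingerprint contributes exactly `1 / K`; only the other `K - 1` contribute
cross terms. -/
lemma abs_meanStat_sub_le {b : ℝ} (hK : 1 ≤ K) (hf : ∀ m, f m ≠ 0)
    (hC : ∀ m m', m ≠ m' → |testStat f m (f m')| ≤ b) (𝒦 : Fin K ↪ Fin M) (k : Fin K) :
    |meanStat f 𝒦 (𝒦 k) - 1 / K| ≤ ((K : ℝ) - 1) / K * b := by
  have hK' : (0 : ℝ) < K := by exact_mod_cast hK
  have hself : testStat f (𝒦 k) (f (𝒦 k)) = 1 := by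
    rw [testStat, real_inner_self_eq_norm_sq, div_self (by simpa using hf _)]
  rw [meanStat, testStat_sum_smul, ← Finset.add_sum_erase _ _ (Finset.mem_univ k), hself,
    uniformWeights, mul_one, add_sub_cancel_left]
  calc |∑ l ∈ Finset.univ.erase k, uniformWeights K l * testStat f (𝒦 k) (f (𝒦 l))|
      ≤ ∑ l ∈ Finset.univ.erase k, |uniformWeights K l * testStat f (𝒦 k) (f (𝒦 l))| :=
        Finset.abs_sum_le_sum_abs _ _
    _ ≤ ∑ _l ∈ Finset.univ.erase k, 1 / (K : ℝ) * b := by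
        refine Finset.sum_le_sum fun l hl => ?_
        rw [abs_mul, uniformWeights, abs_of_pos (by positivity)]
        exact mul_le_mul_of_nonneg_left
          (hC _ _ fun h => Finset.ne_of_mem_erase hl (𝒦.injective h).symm) (by positivity)
    _ = ((K : ℝ) - 1) / K * b := by
        simp [Finset.card_erase_of_mem, Nat.cast_sub hK]; ring

lemma sqrt_mul_testStat_forgery (𝒦 : Fin K ↪ Fin M) (m : Fin M) (ε : Fin N → ℝ) :
    √N * testStat f m (forgery f 𝒦 (uniformWeights K) ε) =
      √N * meanStat f 𝒦 m + ∑ i, ε i * (√N * f m i / ‖f m‖ ^ 2) := by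
  have h : ∑ i, ε i * (√N * f m i / ‖f m‖ ^ 2) =
      √N * (inner ℝ (WithLp.toLp 2 ε) (f m) / ‖f m‖ ^ 2) := by
    simp only [PiLp.inner_apply, RCLike.inner_apply, conj_trivial, Finset.sum_div, Finset.mul_sum]
    exact Finset.sum_congr rfl fun i _ => by ring
  rw [h, meanStat, testStat, testStat, forgery, inner_add_left]
  ring

lemma fingerprint_ne_zero (hN : 1 ≤ N) (hσ : 0 < σ) (hE : ∀ m, ‖f m‖ ^ 2 = (N : ℝ) * σ ^ 2)
    (m : Fin M) : f m ≠ 0 := by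
  have hN' : (0 : ℝ) < N := by exact_mod_cast hN
  intro h
  have hm := hE m
  have : 0 < (N : ℝ) * σ ^ 2 := by positivity
  rw [h, norm_zero] at hm
  linarith

/-- The factor `√N` standardizes the noise term because the energy per coordinate equals the noise
variance. -/
lemma noise_scale (hN : 1 ≤ N) (hσ : 0 < σ) (hE : ∀ m, ‖f m‖ ^ 2 = (N : ℝ) * σ ^ 2)
    (m : Fin M) : σ ^ 2 * ∑ i, (√N * f m i / ‖f m‖ ^ 2) ^ 2 = 1 := by
  have hN' : (0 : ℝ) < N := by exact_mod_cast hN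
  have h := hE m
  simp_rw [div_pow, mul_pow, Real.sq_sqrt hN'.le, ← Finset.sum_div, ← Finset.mul_sum]
  rw [← EuclideanSpace.real_norm_sq_eq, h]
  field_simp

lemma probAccused_eq (hN : 1 ≤ N) (hσ : 0 < σ) (hE : ∀ m, ‖f m‖ ^ 2 = (N : ℝ) * σ ^ 2)
    (𝒦 : Fin K ↪ Fin M) (m : Fin M) (τ : ℝ) :
    probAccused f σ m τ 𝒦 (uniformWeights K) = gaussianTail (√N * (τ - meanStat f 𝒦 m)) := by
  have hN' : (0 : ℝ) < √N := Real.sqrt_pos.2 (by exact_mod_cast hN)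
  rw [probAccused, ← noise_real_le _ (noise_scale hN hσ hE m)]
  congr 1
  ext ε
  simp only [Set.mem_ofPred_eq]
  rw [← mul_le_mul_iff_right₀ hN', sqrt_mul_testStat_forgery, mul_sub, sub_le_iff_le_add']

lemma probCleared_eq (hN : 1 ≤ N) (hσ : 0 < σ) (hE : ∀ m, ‖f m‖ ^ 2 = (N : ℝ) * σ ^ 2)
    (𝒦 : Fin K ↪ Fin M) (m : Fin M) (τ : ℝ) :
    probCleared f σ m τ 𝒦 (uniformWeights K) = gaussianTail (√N * (meanStat f 𝒦 m - τ)) := by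
  have hN' : (0 : ℝ) < √N := Real.sqrt_pos.2 (by exact_mod_cast hN)
  rw [probCleared, ← neg_sub, mul_neg, ← noise_real_lt _ (noise_scale hN hσ hE m)]
  congr 1
  ext ε
  simp only [Set.mem_ofPred_eq]
  rw [← mul_lt_mul_iff_right₀ hN', sqrt_mul_testStat_forgery, mul_sub, lt_sub_iff_add_lt']

lemma continuous_probError (hN : 1 ≤ N) (hσ : 0 < σ) (hE : ∀ m, ‖f m‖ ^ 2 = (N : ℝ) * σ ^ 2) :
    Continuous fun τ => probError f σ τ (uniformWeights K) := by
  refine Continuous.max (continuous_ciSup_of_finite fun 𝒦 => continuous_ciSup_of_finite fun m => ?_)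
    (continuous_ciSup_of_finite fun 𝒦 => continuous_ciInf_of_finite fun k => ?_)
  · simp_rw [probAccused_eq hN hσ hE]
    exact continuous_gaussianTail.comp (by fun_prop)
  · simp_rw [probCleared_eq hN hσ hE]
    exact continuous_gaussianTail.comp (by fun_prop)

lemma le_typeI (hN : 1 ≤ N) (hσ : 0 < σ) (hE : ∀ m, ‖f m‖ ^ 2 = (N : ℝ) * σ ^ 2)
    (hK : 1 ≤ K) (hKM : K < M)
    (hC : ∀ m m', m ≠ m' → |testStat f m (f m')| ≤ 1 / √N)
    (τ : ℝ) : gaussianTail (√N * τ + 1) ≤ typeI f σ τ (uniformWeights K) := by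
  have hN' : (0 : ℝ) < √N := Real.sqrt_pos.2 (by exact_mod_cast hN)
  -- One coalition suffices for a lower bound: the first `K` users, with user `K` (counting from
  -- zero) innocent.
  let 𝒦 : Fin K ↪ Fin M := Fin.castLEEmb hKM.le
  have hm : (⟨K, hKM⟩ : Fin M) ∉ Set.range 𝒦 := by
    rintro ⟨k, hk⟩
    have := congrArg Fin.val hk
    simp [𝒦] at this
    have := k.2
    omega
  refine le_ciSup_of_le (Set.finite_range _).bddAbove 𝒦
    (le_ciSup_of_le (Set.finite_range _).bddAbove ⟨_, hm⟩ ?_)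
  rw [probAccused_eq hN hσ hE]
  refine gaussianTail_antitone ?_
  have h := (abs_le.1 (abs_meanStat_le hK hC hm)).1
  calc √N * (τ - meanStat f 𝒦 ⟨K, hKM⟩) ≤ √N * (τ + 1 / √N) := by
        gcongr
        linarith
    _ = √N * τ + 1 := by field_simp

lemma le_typeII (hN : 1 ≤ N) (hσ : 0 < σ) (hE : ∀ m, ‖f m‖ ^ 2 = (N : ℝ) * σ ^ 2)
    (hK : 1 ≤ K) (hKM : K < M)
    (hC : ∀ m m', m ≠ m' → |testStat f m (f m')| ≤ 1 / √N)
    (τ : ℝ) :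
    gaussianTail (√N * (1 / K - τ) + 1) ≤ typeII f σ τ (uniformWeights K) := by
  have hN' : (0 : ℝ) < √N := Real.sqrt_pos.2 (by exact_mod_cast hN)
  have hK' : (0 : ℝ) < K := by exact_mod_cast hK
  have hf := fingerprint_ne_zero hN hσ hE
  have : Nonempty (Fin K) := ⟨⟨0, hK⟩⟩
  refine le_ciSup_of_le (Set.finite_range _).bddAbove (Fin.castLEEmb hKM.le)
    (le_ciInf fun k => ?_)
  rw [probCleared_eq hN hσ hE]
  refine gaussianTail_antitone ?_
  have h := (abs_le.1 (abs_meanStat_sub_le hK hf hC (Fin.castLEEmb hKM.le) k)).2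
  have h1 : ((K : ℝ) - 1) / K * (1 / √N) ≤ 1 * (1 / √N) := by
    gcongr
    rw [div_le_one hK']
    linarith
  calc √N * (meanStat f (Fin.castLEEmb hKM.le) (Fin.castLEEmb hKM.le k) - τ)
      ≤ √N * (1 / K - τ + 1 / √N) := by
        gcongr
        linarith
    _ = √N * (1 / K - τ) + 1 := by field_simp

/-- A threshold below `1 / (2 K)` is too close to the innocent means, one above it too close to the
guilty means. -/
lemma le_probError (hN : 1 ≤ N) (hσ : 0 < σ) (hE : ∀ m, ‖f m‖ ^ 2 = (N : ℝ) * σ ^ 2)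
    (hK : 1 ≤ K) (hKM : K < M)
    (hC : ∀ m m', m ≠ m' → |testStat f m (f m')| ≤ 1 / √N)
    (τ : ℝ) :
    gaussianTail (√N / (2 * K) + 1) ≤ probError f σ τ (uniformWeights K) := by
  have hN' : (0 : ℝ) < √N := Real.sqrt_pos.2 (by exact_mod_cast hN)
  have hK' : (0 : ℝ) < K := by exact_mod_cast hK
  rcases le_total τ (1 / (2 * K)) with h | h
  · refine le_trans (gaussianTail_antitone ?_)
      ((le_typeI hN hσ hE hK hKM hC τ).trans (le_max_left _ _))
    have := mul_le_mul_of_nonneg_left h hN'.le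
    rw [mul_one_div] at this
    linarith
  · refine le_trans (gaussianTail_antitone ?_)
      ((le_typeII hN hσ hE hK hKM hC τ).trans (le_max_right _ _))
    have : 1 / (K : ℝ) - τ ≤ 1 / (2 * K) := by
      have : 1 / (K : ℝ) = 1 / (2 * K) + 1 / (2 * K) := by field_simp; norm_num
      linarith
    have := mul_le_mul_of_nonneg_left this hN'.le
    rw [mul_one_div] at this
    linarith

lemma probError_le (hN : 1 ≤ N) (hσ : 0 < σ) (hE : ∀ m, ‖f m‖ ^ 2 = (N : ℝ) * σ ^ 2)
    (hK : 1 ≤ K)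
    (hC : ∀ m m', m ≠ m' → |testStat f m (f m')| ≤ 1 / √N)
    {μ : ℝ} (hμ0 : 0 ≤ μ) (hμ : μ ≤ 1 / √N) :
    probError f σ ((1 + μ) / (2 * K)) (uniformWeights K) ≤ gaussianTail (√N / (2 * K) - 1) := by
  have hN' : (0 : ℝ) < √N := Real.sqrt_pos.2 (by exact_mod_cast hN)
  have hK' : (0 : ℝ) < K := by exact_mod_cast hK
  have hf := fingerprint_ne_zero hN hσ hE
  have hscale : √N / (2 * K) - 1 = √N * (1 / (2 * K) - 1 / √N) := by field_simp
  have hmid : (1 + μ) / (2 * K) = 1 / (2 * K) + μ / (2 * K) := by ring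
  have hmid0 : 0 ≤ μ / (2 * K) := by positivity
  have hmid1 : μ / (2 * K) ≤ 1 / √N / (2 * K) := by gcongr
  rw [hscale, hmid]
  -- An empty supremum is `0` here, so nonnegativity of the tail covers the absence of innocent
  -- users or of coalitions.
  refine max_le (Real.iSup_le (fun 𝒦 => Real.iSup_le (fun m => ?_) (gaussianTail_nonneg _))
    (gaussianTail_nonneg _)) (Real.iSup_le (fun 𝒦 => ?_) (gaussianTail_nonneg _))
  · rw [probAccused_eq hN hσ hE]
    refine gaussianTail_antitone (mul_le_mul_of_nonneg_left ?_ hN'.le)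
    have h := (abs_le.1 (abs_meanStat_le hK hC m.2)).2
    linarith
  · refine ciInf_le_of_le (Set.finite_range _).bddBelow (⟨0, hK⟩ : Fin K) ?_
    rw [probCleared_eq hN hσ hE]
    refine gaussianTail_antitone (mul_le_mul_of_nonneg_left ?_ hN'.le)
    have h := (abs_le.1 (abs_meanStat_sub_le hK hf hC 𝒦 ⟨0, hK⟩)).1
    have h1 : 1 / (K : ℝ) = 1 / (2 * K) + 1 / (2 * K) := by field_simp; norm_num
    -- The missing self cross term leaves a slack of `1 / √N / K`; half of it absorbs the threshold
    -- offset `μ / (2 * K)`.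
    have h2 : ((K : ℝ) - 1) / K * (1 / √N) + 1 / √N / (2 * K) + 1 / √N / (2 * K) = 1 / √N := by
      field_simp
      ring
    have h3 : 0 ≤ 1 / √N / (2 * K) := by positivity
    linarith

/-- The worst-case error probability is continuous in the threshold and tends to `1` at `±∞`. -/
lemma exists_isMinmaxThreshold (hN : 1 ≤ N) (hσ : 0 < σ) (hE : ∀ m, ‖f m‖ ^ 2 = (N : ℝ) * σ ^ 2)
    (hK : 1 ≤ K) (hKM : K < M)
    (hC : ∀ m m', m ≠ m' → |testStat f m (f m')| ≤ 1 / √N)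
    {t₀ : ℝ} (ht₀ : probError f σ t₀ (uniformWeights K) < 1) :
    ∃ t, IsMinmaxThreshold f σ (uniformWeights K) t := by
  have hN' : (0 : ℝ) < √N := Real.sqrt_pos.2 (by exact_mod_cast hN)
  -- Outside a compact set the error exceeds its value at `t₀`: type I error tends to `1` at `-∞`,
  -- type II at `+∞`.
  refine (continuous_probError hN hσ hE).exists_forall_le' t₀ ?_
  rw [cocompact_eq_atBot_atTop, eventually_sup]
  have h1 : Tendsto (fun τ : ℝ => √N * τ + 1) atBot atBot :=
    tendsto_atBot_add_const_right _ _ (tendsto_id.const_mul_atBot hN')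
  have h2 : Tendsto (fun τ : ℝ => √N * (1 / K - τ) + 1) atTop atBot :=
    tendsto_atBot_add_const_right _ _
      ((tendsto_atBot_add_const_left _ _ tendsto_neg_atTop_atBot).const_mul_atBot hN')
  constructor
  · filter_upwards [(tendsto_gaussianTail_atBot.comp h1).eventually_const_lt ht₀] with τ hτ
    exact hτ.le.trans ((le_typeI hN hσ hE hK hKM hC τ).trans (le_max_left _ _))
  · filter_upwards [(tendsto_gaussianTail_atBot.comp h2).eventually_const_lt ht₀] with τ hτ
    exact hτ.le.trans ((le_typeII hN hσ hE hK hKM hC τ).trans (le_max_right _ _))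

end Configuration

end Fingerprint

/-! ### Logarithmic asymptotics and conclusion -/

namespace Fingerprint

lemma IsETF.abs_testStat_le {N M : ℕ} {f : Fin M → EuclideanSpace ℝ (Fin N)} {c : ℝ}
    (h : IsETF (normalized f)) (hN : 1 ≤ N) (hE : ∀ m, ‖f m‖ ^ 2 = c) {m m' : Fin M}
    (hm : m ≠ m') : |testStat f m (f m')| ≤ 1 / √N := by
  have hnorm : ‖f m'‖ = ‖f m‖ := by
    rw [← sq_eq_sq₀ (norm_nonneg _) (norm_nonneg _), hE, hE]
  convert h.abs_inner_le hN hm.symm using 2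
  rw [normalized, normalized, real_inner_smul_left, real_inner_smul_right, hnorm, testStat,
    div_eq_inv_mul, sq, mul_inv, mul_assoc]

lemma coherence_nonneg {N M : ℕ} (φ : Fin M → EuclideanSpace ℝ (Fin N)) : 0 ≤ coherence φ :=
  Real.iSup_nonneg fun _ => abs_nonneg _

lemma IsETF.coherence_le {N M : ℕ} {φ : Fin M → EuclideanSpace ℝ (Fin N)} (h : IsETF φ)
    (hN : 1 ≤ N) : coherence φ ≤ 1 / √N :=
  Real.iSup_le (fun p => h.abs_inner_le hN p.2) (by positivity)

/-- The condition `2 ≤ a` keeps `a / 2 - 1` nonnegative for the exponential bound; `a / 2 + 2`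
includes the extra unit from `le_gaussianTail`. -/
lemma neg_log_mem_of_gaussianTail {a p : ℝ} (ha : 2 ≤ a) (h₁ : gaussianTail (a / 2 + 1) ≤ p)
    (h₂ : p ≤ gaussianTail (a / 2 - 1)) :
    (a / 2 - 1) ^ 2 / 2 ≤ -Real.log p ∧
      -Real.log p ≤ (a / 2 + 2) ^ 2 / 2 + Real.log √(2 * Real.pi) := by
  have hπ : 0 < √(2 * Real.pi) := by positivity
  have h₁' := (le_gaussianTail (x := a / 2 + 1) (by linarith)).trans h₁
  have h₂' := h₂.trans (gaussianTail_le_exp (x := a / 2 - 1) (by linarith))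
  have hp : 0 < p := lt_of_lt_of_le (by positivity) h₁'
  have l₂ := Real.log_le_log hp h₂'
  have l₁ := Real.log_le_log (by positivity) h₁'
  rw [Real.log_exp] at l₂
  rw [Real.log_mul (by positivity) (by positivity), Real.log_inv, Real.log_exp] at l₁
  constructor
  · linarith
  · have : a / 2 + 1 + 1 = a / 2 + 2 := by ring
    rw [this] at l₁
    linarith

/-- The logarithmic asymptotics of a quantity squeezed between Gaussian tails. -/
lemma tendsto_neg_log_div_of_gaussianTail {a p : ℕ → ℝ} (ha : Tendsto a atTop atTop)
    (h₁ : ∀ᶠ n in atTop, gaussianTail (a n / 2 + 1) ≤ p n)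
    (h₂ : ∀ᶠ n in atTop, p n ≤ gaussianTail (a n / 2 - 1)) :
    Tendsto (fun n => 8 * -Real.log (p n) / a n ^ 2) atTop (𝓝 1) := by
  have hi : Tendsto (fun n => (a n)⁻¹) atTop (𝓝 0) := tendsto_inv_atTop_zero.comp ha
  set C := Real.log √(2 * Real.pi)
  have lo : Tendsto (fun n => (1 - 2 * (a n)⁻¹) ^ 2) atTop (𝓝 1) := by
    simpa using ((hi.const_mul 2).const_sub 1).pow 2
  have hi' : Tendsto (fun n => (1 + 4 * (a n)⁻¹) ^ 2 + 8 * C * (a n)⁻¹ ^ 2) atTop (𝓝 1) := by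
    simpa using (((hi.const_mul 4).const_add 1).pow 2).add ((hi.pow 2).const_mul (8 * C))
  refine tendsto_of_tendsto_of_tendsto_of_le_of_le' lo hi' ?_ ?_
  · filter_upwards [h₁, h₂, ha.eventually_ge_atTop 2] with n h₁ h₂ h₃
    have h₃' : 0 < a n := by linarith
    rw [le_div_iff₀ (by positivity)]
    have := (neg_log_mem_of_gaussianTail h₃ h₁ h₂).1
    have e : (1 - 2 * (a n)⁻¹) ^ 2 * a n ^ 2 = 8 * ((a n / 2 - 1) ^ 2 / 2) := by
      field_simp
      ring
    linarith
  · filter_upwards [h₁, h₂, ha.eventually_ge_atTop 2] with n h₁ h₂ h₃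
    have h₃' : 0 < a n := by linarith
    rw [div_le_iff₀ (by positivity)]
    have := (neg_log_mem_of_gaussianTail h₃ h₁ h₂).2
    have e : ((1 + 4 * (a n)⁻¹) ^ 2 + 8 * C * (a n)⁻¹ ^ 2) * a n ^ 2 =
        8 * ((a n / 2 + 2) ^ 2 / 2 + C) := by
      field_simp
      ring
    linarith

end Fingerprint

theorem mainTheorem5
    (N M K : ℕ → ℕ) (σ D : ℕ → ℝ)
    (f : (n : ℕ) → Fin (M n) → EuclideanSpace ℝ (Fin (N n)))
    (hσ : ∀ n, 0 < σ n)
    (hWNR : ∀ n, D n = σ n ^ 2)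
    (hK : ∀ n, 1 ≤ K n)
    (henergy : ∀ n m, ‖f n m‖ ^ 2 = (N n : ℝ) * D n)
    (hETF : ∀ n, Fingerprint.IsETF (Fingerprint.normalized (f n)))
    (hN : Tendsto N atTop atTop)
    (hMN : Tendsto (fun n => (M n : ℝ) / (N n : ℝ)) atTop atTop)
    (hNK : Tendsto (fun n => (N n : ℝ) / (K n : ℝ) ^ 2) atTop atTop) :
    (∀ᶠ n in atTop, ∃ t : ℝ, Fingerprint.IsMinmaxThreshold (f n) (σ n)
      (Fingerprint.uniformWeights (K n)) t) ∧
    ∀ τ : ℕ → ℝ,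
      ((∀ᶠ n in atTop, Fingerprint.IsMinmaxThreshold (f n) (σ n)
          (Fingerprint.uniformWeights (K n)) (τ n)) ∨
        (∀ᶠ n in atTop, τ n = Fingerprint.midThreshold (f n) (K n))) →
      ((fun n => -(1 / (N n : ℝ) * Real.log (Fingerprint.probError (f n) (σ n) (τ n)
          (Fingerprint.uniformWeights (K n))))) ~[atTop] fun n => 1 / (8 * (K n : ℝ) ^ 2)) ∧
      ∀ k : ℕ, (∀ᶠ n in atTop, K n = k) →
        Tendsto (fun n => -(1 / (N n : ℝ) * Real.log (Fingerprint.probError (f n) (σ n) (τ n)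
          (Fingerprint.uniformWeights (K n))))) atTop (𝓝 (1 / (8 * (k : ℝ) ^ 2))) := by
  have hE : ∀ n m, ‖f n m‖ ^ 2 = (N n : ℝ) * σ n ^ 2 := fun n m => by rw [henergy, hWNR]
  have ha : Tendsto (fun n => √(N n) / (K n : ℝ)) atTop atTop := by
    refine (Real.tendsto_sqrt_atTop.comp hNK).congr fun n => ?_
    simp
  have hN1 : ∀ᶠ n in atTop, 1 ≤ N n := hN.eventually_ge_atTop 1
  have hKM : ∀ᶠ n in atTop, K n < M n := by
    filter_upwards [hN1, hMN.eventually_ge_atTop 1, hNK.eventually_gt_atTop 1] with n h₁ h₂ h₃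
    have hK' : (1 : ℝ) ≤ K n := by exact_mod_cast hK n
    have hN' : (0 : ℝ) < N n := by exact_mod_cast h₁
    rw [one_le_div hN'] at h₂
    rw [one_lt_div (by positivity)] at h₃
    -- Eventually `K ≤ K² < N ≤ M`, so an innocent user exists.
    have : (K n : ℝ) < M n := by nlinarith
    exact_mod_cast this
  have hC : ∀ᶠ n in atTop, ∀ m m', m ≠ m' →
      |Fingerprint.testStat (f n) m (f n m')| ≤ 1 / √(N n) := by
    filter_upwards [hN1] with n h₁ m m' hm using (hETF n).abs_testStat_le h₁ (hE n) hm
  have hhalf : ∀ n, √(N n : ℝ) / (2 * K n) = √(N n) / K n / 2 := fun n => by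
    rw [div_div, mul_comm]
  have hlow : ∀ᶠ n in atTop, ∀ t : ℝ, Fingerprint.gaussianTail (√(N n) / K n / 2 + 1) ≤
      Fingerprint.probError (f n) (σ n) t (Fingerprint.uniformWeights (K n)) := by
    filter_upwards [hN1, hKM, hC] with n h₁ h₂ h₃ t
    rw [← hhalf]
    exact Fingerprint.le_probError h₁ (hσ n) (hE n) (hK n) h₂ h₃ t
  have hup : ∀ᶠ n in atTop, Fingerprint.probError (f n) (σ n)
      (Fingerprint.midThreshold (f n) (K n)) (Fingerprint.uniformWeights (K n)) ≤
      Fingerprint.gaussianTail (√(N n) / K n / 2 - 1) := by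
    filter_upwards [hN1, hC] with n h₁ h₃
    rw [← hhalf]
    exact Fingerprint.probError_le h₁ (hσ n) (hE n) (hK n) h₃
      (Fingerprint.coherence_nonneg _) ((hETF n).coherence_le h₁)
  refine ⟨?_, fun τ hτ => ?_⟩
  · filter_upwards [hN1, hKM, hC, hup, ha.eventually_gt_atTop 2] with n h₁ h₂ h₃ h₄ h₅
    refine Fingerprint.exists_isMinmaxThreshold h₁ (hσ n) (hE n) (hK n) h₂ h₃
      (h₄.trans_lt ?_)
    have h₆ : 0 < √(N n : ℝ) / K n / 2 - 1 := by linarith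
    refine (Fingerprint.gaussianTail_le_exp h₆.le).trans_lt (Real.exp_lt_one_iff.2 ?_)
    have := pow_pos h₆ 2
    linarith
  · have hupτ : ∀ᶠ n in atTop, Fingerprint.probError (f n) (σ n) (τ n)
        (Fingerprint.uniformWeights (K n)) ≤
        Fingerprint.gaussianTail (√(N n) / K n / 2 - 1) := by
      rcases hτ with hτ | hτ
      · filter_upwards [hτ, hup] with n h₁ h₂ using (h₁ _).trans h₂
      · filter_upwards [hτ, hup] with n h₁ h₂
        rwa [h₁]
    have hequiv : (fun n => -(1 / (N n : ℝ) * Real.log (Fingerprint.probError (f n) (σ n) (τ n)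
        (Fingerprint.uniformWeights (K n))))) ~[atTop] fun n => 1 / (8 * (K n : ℝ) ^ 2) := by
      have hK' : ∀ n, (0 : ℝ) < K n := fun n => by exact_mod_cast hK n
      rw [isEquivalent_iff_tendsto_one (Eventually.of_forall fun n => by
        have := hK' n
        positivity)]
      -- With `a = √N / K`, the required ratio is exactly `8 * -log p / a ^ 2`.
      refine (Fingerprint.tendsto_neg_log_div_of_gaussianTail ha
        (hlow.mono fun n h => h (τ n)) hupτ).congr' ?_
      filter_upwards [hN1] with n h₁
      have hN' : (0 : ℝ) < N n := by exact_mod_cast h₁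
      have := hK' n
      simp only [Pi.div_apply, div_pow, Real.sq_sqrt hN'.le]
      field_simp
    refine ⟨hequiv, fun k hk => ?_⟩
    refine hequiv.symm.tendsto_nhds (tendsto_const_nhds.congr' ?_)
    filter_upwards [hk] with n h
    rw [h]
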